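/- Let $H$ be a (real or complex) Hilbert space with inner product $(\cdot,\cdot)$. A positive, symmetric operator in $H$ is a linear operator $a:\mathrm{dom}\,a\to H$, defined on a not necessarily dense linear subspace $\mathrm{dom}\,a\subseteq H$, with $(ax,y)=(x,ay)$ and $(ax,x)\ge 0$ for all $x,y\in\mathrm{dom}\,a$. Its form domain is $$\mathrm{fdom}\,a=\{y\in H:\ \exists\, m_y\in\mathbb{R}\ \ \forall x\in\mathrm{dom}\,a\quad |(ax,y)|^2\le m_y\,(ax,x)\}.$$ If $\mathrm{fdom}\,a$ is dense in $H$, then $\langle ax,ay\rangle=(ax,y)$ is an inner product on $\mathrm{ran}\,a$; let $H_a$ be the completion of $\mathrm{ran}\,a$ with respect to it, and let $J_a:H_a\to H$ be the densely defined operator with $\mathrm{dom}\,J_a=\mathrm{ran}\,a$ and $J_a(ax)=ax$. The Krein–von Neumann extension of $a$ is the operator $a_{\mathsf K}=J_a^{**}J_a^{*}$ in $H$, with its natural domain $\{y\in\mathrm{dom}\,J_a^*:\ J_a^*y\in\mathrm{dom}\,J_a^{**}\}$. For operators $a,b$ in $H$, the direct sum $a\oplus b$ is the operator in the Hilbert space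 $H\oplus H$ with domain $\mathrm{dom}\,a\oplus\mathrm{dom}\,b$ given by $(a\oplus b)(x\oplus y)=ax\oplus by$. Let $a,b$ be positive, symmetric operators in $H$ such that $\mathrm{fdom}\,a$ and $\mathrm{fdom}\,b$ are dense in $H$. Then $\mathrm{fdom}(a\oplus b)$ is dense in $H\oplus H$, and $$a_{\mathsf K}\oplus b_{\mathsf K}=(a\oplus b)_{\mathsf K}$$ as operators in $H\oplus H$, including equality of domains. -/

import Mathlib

noncomputable section

namespace KreinVonNeumann

open RCLike

section Operators

variable {𝕜 E F G : Type*} [RCLike 𝕜]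
  [NormedAddCommGroup E] [InnerProductSpace 𝕜 E]
  [NormedAddCommGroup F] [InnerProductSpace 𝕜 F]
  [NormedAddCommGroup G] [InnerProductSpace 𝕜 G]

/-- `a` is a positive, symmetric operator in `E`; its domain is any linear subspace. -/
structure IsPosSymm (a : E →ₗ.[𝕜] E) : Prop where
  symm : ∀ x y : a.domain, inner 𝕜 (a x) (y : E) = inner 𝕜 (x : E) (a y)
  nonneg : ∀ x : a.domain, 0 ≤ re (inner 𝕜 (a x) (x : E))

/-- The form domain of `a`: all `y` such that, for some constant `m`,
`|(a x, y)|² ≤ m (a x, x)` for every `x ∈ dom a`. -/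
def fdom (a : E →ₗ.[𝕜] E) : Set E :=
  {y | ∃ m : ℝ, ∀ x : a.domain, ‖inner 𝕜 (a x) y‖ ^ 2 ≤ m * re (inner 𝕜 (a x) (x : E))}

/-- The product `g f` of two operators, with domain `{x ∈ dom f | f x ∈ dom g}`. -/
def mulOp (g : F →ₗ.[𝕜] G) (f : E →ₗ.[𝕜] F) : E →ₗ.[𝕜] G :=
  g.comp (f.domRestrict ((g.domain.comap f.toFun).map f.domain.subtype)) <| by
    rintro ⟨_, ⟨y, hy, rfl⟩, hx⟩
    exact hy

/-- The direct sum `a ⊕ b`, acting in the Hilbert space direct sum `E ⊕ F`, with domain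
`dom a ⊕ dom b`. -/
def directSum (a : E →ₗ.[𝕜] E) (b : F →ₗ.[𝕜] F) :
    WithLp 2 (E × F) →ₗ.[𝕜] WithLp 2 (E × F) where
  domain := (a.domain.prod b.domain).comap (WithLp.linearEquiv 2 𝕜 (E × F)).toLinearMap
  toFun :=
    { toFun := fun z => WithLp.toLp 2 (a ⟨(z : WithLp 2 (E × F)).fst, z.2.1⟩,
        b ⟨(z : WithLp 2 (E × F)).snd, z.2.2⟩)
      map_add' := fun z w => by
        rw [← WithLp.toLp_add, Prod.mk_add_mk, ← a.map_add, ← b.map_add]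
        rfl
      map_smul' := fun c z => by
        rw [RingHom.id_apply, ← WithLp.toLp_smul, Prod.smul_mk, ← a.map_smul, ← b.map_smul]
        rfl }

theorem IsPosSymm.directSum {a : E →ₗ.[𝕜] E} {b : F →ₗ.[𝕜] F}
    (ha : IsPosSymm a) (hb : IsPosSymm b) : IsPosSymm (directSum a b) where
  symm z w := congrArg₂ (· + ·) (ha.symm ⟨_, z.2.1⟩ ⟨_, w.2.1⟩) (hb.symm ⟨_, z.2.2⟩ ⟨_, w.2.2⟩)
  nonneg z := by
    have h := add_nonneg (ha.nonneg ⟨_, z.2.1⟩) (hb.nonneg ⟨_, z.2.2⟩)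
    rw [← map_add] at h
    exact h

/-- The range of `a`, to be equipped with the inner product `⟨a x, a y⟩ = (a x, y)`. -/
@[nolint unusedArguments]
def Ran (a : E →ₗ.[𝕜] E) (_ha : IsPosSymm a) (_hd : Dense (fdom a)) : Type _ :=
  LinearMap.range a.toFun

variable {a : E →ₗ.[𝕜] E} (ha : IsPosSymm a) (hd : Dense (fdom a))

instance : AddCommGroup (Ran a ha hd) := inferInstanceAs (AddCommGroup (LinearMap.range a.toFun))

instance : Module 𝕜 (Ran a ha hd) := inferInstanceAs (Module 𝕜 (LinearMap.range a.toFun))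

/-- The inclusion of `ran a` in `E`. -/
def Ran.incl : Ran a ha hd →ₗ[𝕜] E := (LinearMap.range a.toFun).subtype

/-- `a x` as an element of `ran a`. -/
def Ran.mk (x : a.domain) : Ran a ha hd := ⟨a x, x, rfl⟩

theorem Ran.exists_mk (u : Ran a ha hd) : ∃ x : a.domain, Ran.mk ha hd x = u := by
  obtain ⟨_, x, rfl⟩ := u
  exact ⟨x, rfl⟩

instance : Inner 𝕜 (Ran a ha hd) where
  inner u v := inner 𝕜 (Ran.incl ha hd u) ((Ran.exists_mk ha hd v).choose : E)

/-- `⟨a x, a y⟩ = (a x, y)`, independently of the choice of `x` and `y`. -/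
theorem Ran.inner_mk (x y : a.domain) :
    inner 𝕜 (Ran.mk ha hd x) (Ran.mk ha hd y) = inner 𝕜 (a x) (y : E) := by
  have h := congrArg (Ran.incl ha hd) (Ran.exists_mk ha hd (Ran.mk ha hd y)).choose_spec
  change a _ = a y at h
  change inner 𝕜 (a x) ((Ran.exists_mk ha hd (Ran.mk ha hd y)).choose : E) = _
  rw [ha.symm, h, ha.symm]

theorem Ran.inner_eq (u : Ran a ha hd) (y : a.domain) :
    inner 𝕜 u (Ran.mk ha hd y) = inner 𝕜 (Ran.incl ha hd u) (y : E) := by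
  obtain ⟨x, rfl⟩ := Ran.exists_mk ha hd u
  exact Ran.inner_mk ha hd x y

/-- `⟨·, ·⟩` is an inner product on `ran a`. -/
instance Ran.core : InnerProductSpace.Core 𝕜 (Ran a ha hd) where
  conj_inner_symm u v := by
    obtain ⟨x, rfl⟩ := Ran.exists_mk ha hd u
    obtain ⟨y, rfl⟩ := Ran.exists_mk ha hd v
    rw [Ran.inner_mk, Ran.inner_mk, inner_conj_symm, ha.symm]
  re_inner_nonneg u := by
    obtain ⟨x, rfl⟩ := Ran.exists_mk ha hd u
    rw [Ran.inner_mk]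
    exact ha.nonneg x
  add_left u v w := by
    obtain ⟨z, rfl⟩ := Ran.exists_mk ha hd w
    rw [Ran.inner_eq, Ran.inner_eq, Ran.inner_eq, map_add, inner_add_left]
  smul_left u v r := by
    obtain ⟨z, rfl⟩ := Ran.exists_mk ha hd v
    rw [Ran.inner_eq, Ran.inner_eq, map_smul, inner_smul_left]
  definite u hu := by
    obtain ⟨x, rfl⟩ := Ran.exists_mk ha hd u
    rw [Ran.inner_mk] at hu
    refine Subtype.ext (hd.eq_zero_of_inner_left 𝕜 (x := a x) ?_)
    rintro y ⟨m, hm⟩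
    have h := hm x
    rw [hu, map_zero, mul_zero] at h
    exact norm_eq_zero.1 (pow_eq_zero_iff two_ne_zero |>.1 (le_antisymm h (sq_nonneg _)))

instance : NormedAddCommGroup (Ran a ha hd) := (Ran.core ha hd).toNormedAddCommGroup

instance : InnerProductSpace 𝕜 (Ran a ha hd) := InnerProductSpace.ofCore (Ran.core ha hd).toCore

/-- The Hilbert space `H_a`: the completion of `ran a` with the inner product
`⟨a x, a y⟩ = (a x, y)`. -/
abbrev HSpace : Type _ := UniformSpace.Completion (Ran a ha hd)

/-- The embedding of `ran a` in its completion. -/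
def HSpace.coe : Ran a ha hd →ₗ[𝕜] HSpace ha hd :=
  (UniformSpace.Completion.toComplₗᵢ (𝕜 := 𝕜) (E := Ran a ha hd)).toLinearMap

theorem HSpace.coe_injective : Function.Injective (HSpace.coe ha hd) :=
  (UniformSpace.Completion.toComplₗᵢ (𝕜 := 𝕜) (E := Ran a ha hd)).injective

/-- The operator `J_a` from `H_a` to `E`, with domain `ran a`: `J_a (a x) = a x`. -/
def J : HSpace ha hd →ₗ.[𝕜] E where
  domain := LinearMap.range (HSpace.coe ha hd)
  toFun := Ran.incl ha hd ∘ₗ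
    (LinearEquiv.ofInjective (HSpace.coe ha hd) (HSpace.coe_injective ha hd)).symm.toLinearMap

/-- The Krein–von Neumann extension `a_K = J_a** J_a*` of a positive, symmetric operator `a`
with dense form domain. -/
def kreinExt [CompleteSpace E] : E →ₗ.[𝕜] E :=
  mulOp (J ha hd).adjoint.adjoint (J ha hd).adjoint

end Operators

end KreinVonNeumann

end

noncomputable section

namespace KreinVonNeumann

open RCLike

/-! ### Graphs of products, sums and adjoints; density of the form domain. -/

variable {𝕜 E F G : Type*} [RCLike 𝕜]
  [NormedAddCommGroup E] [InnerProductSpace 𝕜 E]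
  [NormedAddCommGroup F] [InnerProductSpace 𝕜 F]
  [NormedAddCommGroup G] [InnerProductSpace 𝕜 G]

/-! The map `(a x, b y) ↦ (a ⊕ b)(x ⊕ y)` is isometric from `ran a ⊕ ran b` onto `ran (a ⊕ b)`, so
it extends to a unitary `U : H_a ⊕ H_b → H_{a ⊕ b}` (`hspaceEquiv`) and gives `J_{a ⊕ b}* = U (J_a*
⊕ J_b*)` (`mem_graph_adjoint_J_directSum`). The extension depends only on the graph of `J*` and on
inner products (`mem_graph_kreinExt`), so `U` cancels. Working with graphs settles domains and
values together. -/

theorem mem_graph_mulOp {g : F →ₗ.[𝕜] G} {f : E →ₗ.[𝕜] F} {x : E} {z : G} :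
    (x, z) ∈ (mulOp g f).graph ↔ ∃ y, (x, y) ∈ f.graph ∧ (y, z) ∈ g.graph := by
  constructor
  · rw [LinearPMap.mem_graph_iff]
    rintro ⟨⟨x, ⟨w, hw, hwx⟩, hx⟩, rfl, rfl⟩
    exact ⟨f ⟨x, hx⟩, f.mem_graph ⟨x, hx⟩, g.mem_graph ⟨f ⟨x, hx⟩, by
      obtain rfl : w = ⟨x, hx⟩ := Subtype.ext hwx
      exact hw⟩⟩
  · rintro ⟨y, hf, hg⟩
    obtain ⟨x, rfl, rfl⟩ := f.mem_graph_iff.1 hf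
    obtain ⟨w, hw, rfl⟩ := g.mem_graph_iff.1 hg
    have hx : f x ∈ g.domain := by
      rw [← show (w : F) = f x from hw]
      exact w.2
    obtain rfl : w = ⟨f x, hx⟩ := Subtype.ext hw
    exact (mulOp g f).mem_graph ⟨x, ⟨x, hx, rfl⟩, x.2⟩

theorem mem_graph_directSum {a : E →ₗ.[𝕜] E} {b : F →ₗ.[𝕜] F} {y v : WithLp 2 (E × F)} :
    (y, v) ∈ (directSum a b).graph ↔
      (y.fst, v.fst) ∈ a.graph ∧ (y.snd, v.snd) ∈ b.graph := by
  constructor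
  · rw [LinearPMap.mem_graph_iff]
    rintro ⟨z, rfl, rfl⟩
    exact ⟨a.mem_graph ⟨_, z.2.1⟩, b.mem_graph ⟨_, z.2.2⟩⟩
  · rintro ⟨h₁, h₂⟩
    obtain ⟨x₁, hx₁, hv₁⟩ := a.mem_graph_iff.1 h₁
    obtain ⟨x₂, hx₂, hv₂⟩ := b.mem_graph_iff.1 h₂
    refine (directSum a b).mem_graph_iff.2
      ⟨⟨WithLp.toLp 2 ((x₁ : E), (x₂ : F)), x₁.2, x₂.2⟩, ?_, ?_⟩
    · exact WithLp.ofLp_injective 2 (Prod.ext hx₁ hx₂)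
    · exact WithLp.ofLp_injective 2 (Prod.ext hv₁ hv₂)

theorem mem_graph_adjoint [CompleteSpace E] {T : E →ₗ.[𝕜] F} (hT : Dense (T.domain : Set E))
    {y : F} {w : E} :
    (y, w) ∈ T.adjoint.graph ↔ ∀ p ∈ T.graph, inner 𝕜 w p.1 = inner 𝕜 y p.2 := by
  rw [LinearPMap.adjoint_graph_eq_graph_adjoint hT, Submodule.mem_adjoint_iff]
  constructor
  · rintro h ⟨x, z⟩ hp
    rw [← inner_conj_symm, ← inner_conj_symm y, ← sub_eq_zero.1 (h x z hp)]
  · intro h x z hp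
    have := h _ hp
    dsimp only at this ⊢
    rw [← inner_conj_symm, ← inner_conj_symm x, this, sub_self]

theorem dense_prod_withLp {s : Set E} {t : Set F} (hs : Dense s) (ht : Dense t) :
    Dense {z : WithLp 2 (E × F) | z.fst ∈ s ∧ z.snd ∈ t} :=
  (hs.prod ht).preimage (WithLp.homeomorphProd 2 E F).isOpenMap

/-- The constants `m`, `n` of a form domain may be negative; with absolute values the cross terms
`|m| s` and `|n| r` are nonnegative and can be added. -/
theorem norm_add_sq_le_of_sq_le {V : Type*} [SeminormedAddCommGroup V] {p q : V} {m n r s : ℝ}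
    (hr : 0 ≤ r) (hs : 0 ≤ s) (hp : ‖p‖ ^ 2 ≤ m * r) (hq : ‖q‖ ^ 2 ≤ n * s) :
    ‖p + q‖ ^ 2 ≤ 2 * (|m| + |n|) * (r + s) :=
  calc ‖p + q‖ ^ 2 ≤ (‖p‖ + ‖q‖) ^ 2 := by gcongr; exact norm_add_le p q
    _ ≤ 2 * (‖p‖ ^ 2 + ‖q‖ ^ 2) := add_sq_le
    _ ≤ 2 * (m * r + n * s) := by gcongr
    _ ≤ 2 * (|m| * r + |n| * s) := by gcongr <;> exact le_abs_self _
    _ ≤ 2 * (|m| + |n|) * (r + s) := by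
      nlinarith [mul_nonneg (abs_nonneg m) hs, mul_nonneg (abs_nonneg n) hr]

theorem dense_fdom_directSum {a : E →ₗ.[𝕜] E} {b : F →ₗ.[𝕜] F} (ha : IsPosSymm a)
    (hb : IsPosSymm b) (hda : Dense (fdom a)) (hdb : Dense (fdom b)) :
    Dense (fdom (directSum a b)) := by
  refine (dense_prod_withLp hda hdb).mono ?_
  rintro y ⟨⟨m, hm⟩, ⟨n, hn⟩⟩
  refine ⟨2 * (|m| + |n|), fun x => ?_⟩
  have h := norm_add_sq_le_of_sq_le (ha.nonneg ⟨_, x.2.1⟩) (hb.nonneg ⟨_, x.2.2⟩)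
    (hm ⟨_, x.2.1⟩) (hn ⟨_, x.2.2⟩)
  rw [← map_add] at h
  exact h

/-! ### The operator `J_a` and its adjoints. -/

section Embedding

variable {a : E →ₗ.[𝕜] E} (ha : IsPosSymm a) (hd : Dense (fdom a))

theorem denseRange_coe : DenseRange (HSpace.coe ha hd) :=
  UniformSpace.Completion.denseRange_coe

theorem Ran.mk_zero : Ran.mk ha hd 0 = 0 :=
  Subtype.ext a.map_zero

theorem mem_graph_J {w : HSpace ha hd} {v : E} :
    (w, v) ∈ (J ha hd).graph ↔
      ∃ x : a.domain, HSpace.coe ha hd (Ran.mk ha hd x) = w ∧ a x = v := by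
  have key (u : Ran a ha hd) :
      J ha hd ⟨HSpace.coe ha hd u, u, rfl⟩ = Ran.incl ha hd u :=
    congrArg (Ran.incl ha hd)
      ((LinearEquiv.ofInjective (HSpace.coe ha hd) (HSpace.coe_injective ha hd)).symm_apply_apply u)
  constructor
  · rw [LinearPMap.mem_graph_iff]
    rintro ⟨⟨_, u, rfl⟩, rfl, rfl⟩
    obtain ⟨x, rfl⟩ := Ran.exists_mk ha hd u
    exact ⟨x, rfl, (key (Ran.mk ha hd x)).symm⟩
  · rintro ⟨x, rfl, rfl⟩
    exact (J ha hd).mem_graph_iff.2 ⟨⟨_, _, rfl⟩, rfl, key _⟩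

theorem dense_domain_J : Dense ((J ha hd).domain : Set (HSpace ha hd)) :=
  denseRange_coe ha hd

theorem mem_graph_adjoint_J {y : E} {w : HSpace ha hd} :
    (y, w) ∈ (J ha hd).adjoint.graph ↔ ∀ x : a.domain,
      inner 𝕜 w (HSpace.coe ha hd (Ran.mk ha hd x)) = inner 𝕜 y (a x) := by
  rw [mem_graph_adjoint (dense_domain_J ha hd)]
  constructor
  · exact fun h x => h (_, _) ((mem_graph_J ha hd).2 ⟨x, rfl, rfl⟩)
  · rintro h ⟨_, _⟩ hp
    obtain ⟨x, rfl, rfl⟩ := (mem_graph_J ha hd).1 hp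
    exact h x

/-- Since `‖a x‖² = (a x, x)` in `H_a`, the form-domain bound says that `a x ↦ (y, a x)` is bounded
by `√|m|`. Hence `J_a*` is densely defined, as `J_a**` requires. -/
theorem fdom_subset_domain_adjoint_J : fdom a ⊆ ((J ha hd).adjoint.domain : Set E) := by
  rintro y ⟨m, hm⟩
  -- Membership in the adjoint's domain is by definition continuity of this functional.
  change Continuous ((innerₛₗ 𝕜 y).comp (J ha hd).toFun)
  refine AddMonoidHomClass.continuous_of_bound ((innerₛₗ 𝕜 y).comp (J ha hd).toFun)
    (Real.sqrt |m|) fun w => ?_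
  obtain ⟨x, hx, hv⟩ := (mem_graph_J ha hd).1 ((J ha hd).mem_graph w)
  change ‖inner 𝕜 y (J ha hd w)‖ ≤ Real.sqrt |m| * ‖(w : HSpace ha hd)‖
  have hn : ‖(w : HSpace ha hd)‖ = Real.sqrt (re (inner 𝕜 (a x) (x : E))) := by
    rw [← hx, ← Ran.inner_mk ha hd, ← norm_eq_sqrt_re_inner]
    exact UniformSpace.Completion.norm_coe _
  rw [← hv, hn, ← Real.sqrt_mul (abs_nonneg m), norm_inner_symm]
  exact Real.le_sqrt_of_sq_le ((hm x).trans
    (mul_le_mul_of_nonneg_right (le_abs_self m) (ha.nonneg x)))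

theorem mem_graph_kreinExt [CompleteSpace E] {y v : E} :
    (y, v) ∈ (kreinExt ha hd).graph ↔ ∃ w, (y, w) ∈ (J ha hd).adjoint.graph ∧
      ∀ p ∈ (J ha hd).adjoint.graph, inner 𝕜 v p.1 = inner 𝕜 w p.2 := by
  simp only [kreinExt, mem_graph_mulOp,
    mem_graph_adjoint (hd.mono (fdom_subset_domain_adjoint_J ha hd))]

end Embedding

/-! ### The unitary between `H_a ⊕ H_b` and `H_{a ⊕ b}`, and the equality. -/

section DirectSum

variable {a : E →ₗ.[𝕜] E} {b : F →ₗ.[𝕜] F} (ha : IsPosSymm a) (hb : IsPosSymm b)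
  (hda : Dense (fdom a)) (hdb : Dense (fdom b)) (hd : Dense (fdom (directSum a b)))

/-- `x ⊕ y` as an element of `dom (a ⊕ b)`. -/
def domainMk (x : a.domain) (y : b.domain) : (directSum a b).domain :=
  ⟨WithLp.toLp 2 ((x : E), (y : F)), x.2, y.2⟩

/-- The map from `ran a ⊕ ran b` to `ran (a ⊕ b)`. -/
def ranMap :
    WithLp 2 (Ran a ha hda × Ran b hb hdb) →ₗ[𝕜] Ran (directSum a b) (ha.directSum hb) hd where
  toFun u := ⟨WithLp.toLp 2 (Ran.incl ha hda u.fst, Ran.incl hb hdb u.snd), by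
    obtain ⟨x, hx⟩ := Ran.exists_mk ha hda u.fst
    obtain ⟨y, hy⟩ := Ran.exists_mk hb hdb u.snd
    rw [← hx, ← hy]
    exact ⟨domainMk x y, rfl⟩⟩
  map_add' _ _ := rfl
  map_smul' _ _ := rfl

theorem ranMap_bijective : Function.Bijective (ranMap ha hb hda hdb hd) := by
  constructor
  · intro u v h
    have h' := congrArg WithLp.ofLp (congrArg Subtype.val h)
    exact WithLp.ofLp_injective 2 (Prod.ext (Subtype.ext (congrArg Prod.fst h'))
      (Subtype.ext (congrArg Prod.snd h')))
  · rintro ⟨_, z, rfl⟩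
    exact ⟨WithLp.toLp 2 (Ran.mk ha hda ⟨_, z.2.1⟩, Ran.mk hb hdb ⟨_, z.2.2⟩), rfl⟩

/-- `ran a ⊕ ran b` is `ran (a ⊕ b)`. -/
def ranEquiv :
    WithLp 2 (Ran a ha hda × Ran b hb hdb) ≃ₗ[𝕜] Ran (directSum a b) (ha.directSum hb) hd :=
  LinearEquiv.ofBijective (ranMap ha hb hda hdb hd) (ranMap_bijective ha hb hda hdb hd)

theorem ranEquiv_mk (x : a.domain) (y : b.domain) :
    ranEquiv ha hb hda hdb hd (WithLp.toLp 2 (Ran.mk ha hda x, Ran.mk hb hdb y)) =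
      Ran.mk (ha.directSum hb) hd (domainMk x y) :=
  rfl

/-- Both squared norms are `(a x, x) + (b y, y)`. -/
theorem norm_ranEquiv (u : WithLp 2 (Ran a ha hda × Ran b hb hdb)) :
    ‖ranEquiv ha hb hda hdb hd u‖ = ‖u‖ := by
  obtain ⟨u, v⟩ := u
  obtain ⟨x, rfl⟩ := Ran.exists_mk ha hda u
  obtain ⟨y, rfl⟩ := Ran.exists_mk hb hdb v
  rw [ranEquiv_mk, norm_eq_sqrt_re_inner (𝕜 := 𝕜), norm_eq_sqrt_re_inner (𝕜 := 𝕜),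
    WithLp.prod_inner_apply, Ran.inner_mk, Ran.inner_mk, Ran.inner_mk]
  rfl

/-- The embedding of `ran a ⊕ ran b` in `H_a ⊕ H_b`. -/
def prodCoe : WithLp 2 (Ran a ha hda × Ran b hb hdb) →ₗ[𝕜]
    WithLp 2 (HSpace ha hda × HSpace hb hdb) :=
  (WithLp.linearEquiv 2 𝕜 _).symm.toLinearMap ∘ₗ
    ((HSpace.coe ha hda).prodMap (HSpace.coe hb hdb)) ∘ₗ (WithLp.linearEquiv 2 𝕜 _).toLinearMap

theorem denseRange_prodCoe : DenseRange (prodCoe ha hb hda hdb) := by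
  refine (dense_prod_withLp (denseRange_coe ha hda) (denseRange_coe hb hdb)).mono ?_
  rintro z ⟨⟨u, hu⟩, ⟨v, hv⟩⟩
  exact ⟨WithLp.toLp 2 (u, v), WithLp.ofLp_injective 2 (Prod.ext hu hv)⟩

theorem norm_prodCoe (u : WithLp 2 (Ran a ha hda × Ran b hb hdb)) :
    ‖prodCoe ha hb hda hdb u‖ = ‖u‖ := by
  rw [WithLp.prod_norm_eq_of_L2, WithLp.prod_norm_eq_of_L2]
  congr 3
  · exact UniformSpace.Completion.norm_coe _
  · exact UniformSpace.Completion.norm_coe _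

/-- `H_a ⊕ H_b` is isometric to `H_{a ⊕ b}`. -/
def hspaceEquiv : WithLp 2 (HSpace ha hda × HSpace hb hdb) ≃ₗᵢ[𝕜] HSpace (ha.directSum hb) hd :=
  (ranEquiv ha hb hda hdb hd).extendOfIsometry (prodCoe ha hb hda hdb)
    (HSpace.coe (ha.directSum hb) hd) (denseRange_prodCoe ha hb hda hdb)
    (denseRange_coe (ha.directSum hb) hd) fun u => by
      rw [norm_prodCoe, ← norm_ranEquiv ha hb hda hdb hd]
      exact UniformSpace.Completion.norm_coe _

theorem hspaceEquiv_coe (x : a.domain) (y : b.domain) :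
    hspaceEquiv ha hb hda hdb hd (WithLp.toLp 2
      (HSpace.coe ha hda (Ran.mk ha hda x), HSpace.coe hb hdb (Ran.mk hb hdb y))) =
      HSpace.coe (ha.directSum hb) hd (Ran.mk (ha.directSum hb) hd (domainMk x y)) :=
  LinearEquiv.extendOfIsometry_eq _ _ _ _ _ _
    (WithLp.toLp 2 (Ran.mk ha hda x, Ran.mk hb hdb y))

/-- `J_{a ⊕ b}*` is `J_a* ⊕ J_b*`, up to the isometry of `H_a ⊕ H_b` with `H_{a ⊕ b}`. -/
theorem mem_graph_adjoint_J_directSum {y : WithLp 2 (E × F)}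
    {w : WithLp 2 (HSpace ha hda × HSpace hb hdb)} :
    (y, hspaceEquiv ha hb hda hdb hd w) ∈ (J (ha.directSum hb) hd).adjoint.graph ↔
      (y.fst, w.fst) ∈ (J ha hda).adjoint.graph ∧ (y.snd, w.snd) ∈ (J hb hdb).adjoint.graph := by
  rw [mem_graph_adjoint_J, mem_graph_adjoint_J, mem_graph_adjoint_J]
  have key (x₁ : a.domain) (x₂ : b.domain) :
      (inner 𝕜 (hspaceEquiv ha hb hda hdb hd w) (HSpace.coe (ha.directSum hb) hd
        (Ran.mk (ha.directSum hb) hd (domainMk x₁ x₂))) =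
        inner 𝕜 y (directSum a b (domainMk x₁ x₂))) ↔
      inner 𝕜 w.fst (HSpace.coe ha hda (Ran.mk ha hda x₁)) +
        inner 𝕜 w.snd (HSpace.coe hb hdb (Ran.mk hb hdb x₂)) =
        inner 𝕜 y.fst (a x₁) + inner 𝕜 y.snd (b x₂) := by
    rw [← hspaceEquiv_coe, LinearIsometryEquiv.inner_map_map]
    rfl
  constructor
  · intro h
    constructor
    · intro x
      -- A zero in the other component isolates one summand.
      have := (key x 0).1 (h _)
      rwa [Ran.mk_zero, map_zero, inner_zero_right, add_zero, b.map_zero, inner_zero_right,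
        add_zero] at this
    · intro x
      have := (key 0 x).1 (h _)
      rwa [Ran.mk_zero, map_zero, inner_zero_right, zero_add, a.map_zero, inner_zero_right,
        zero_add] at this
  · rintro ⟨h₁, h₂⟩ x
    exact (key ⟨_, x.2.1⟩ ⟨_, x.2.2⟩).2 (congrArg₂ (· + ·) (h₁ _) (h₂ _))

theorem directSum_kreinExt [CompleteSpace E] [CompleteSpace F] :
    directSum (kreinExt ha hda) (kreinExt hb hdb) = kreinExt (ha.directSum hb) hd := by
  refine LinearPMap.eq_of_eq_graph ?_
  ext ⟨y, v⟩
  -- By surjectivity of `U`, the intermediate vector `J_{a ⊕ b}* y` may be sought as `U w`.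
  rw [mem_graph_directSum, mem_graph_kreinExt, mem_graph_kreinExt, mem_graph_kreinExt,
    (hspaceEquiv ha hb hda hdb hd).surjective.exists]
  constructor
  · rintro ⟨⟨w₁, hw₁, h₁⟩, ⟨w₂, hw₂, h₂⟩⟩
    refine ⟨WithLp.toLp 2 (w₁, w₂),
      (mem_graph_adjoint_J_directSum ha hb hda hdb hd).2 ⟨hw₁, hw₂⟩, ?_⟩
    rintro ⟨z, t⟩ hp
    obtain ⟨t, rfl⟩ := (hspaceEquiv ha hb hda hdb hd).surjective t
    obtain ⟨hp₁, hp₂⟩ := (mem_graph_adjoint_J_directSum ha hb hda hdb hd).1 hp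
    rw [LinearIsometryEquiv.inner_map_map]
    exact congrArg₂ (· + ·) (h₁ _ hp₁) (h₂ _ hp₂)
  · rintro ⟨w, hw, h⟩
    obtain ⟨hw₁, hw₂⟩ := (mem_graph_adjoint_J_directSum ha hb hda hdb hd).1 hw
    refine ⟨⟨w.fst, hw₁, ?_⟩, ⟨w.snd, hw₂, ?_⟩⟩
    · rintro ⟨z, t⟩ hp
      -- `(0, 0)` lies in the graph of `J_b*`, so a pair from `J_a*` alone is an admissible test
      -- vector.
      have := h (WithLp.toLp 2 (z, 0), hspaceEquiv ha hb hda hdb hd (WithLp.toLp 2 (t, 0)))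
        ((mem_graph_adjoint_J_directSum ha hb hda hdb hd).2 ⟨hp, Submodule.zero_mem _⟩)
      simpa [LinearIsometryEquiv.inner_map_map] using this
    · rintro ⟨z, t⟩ hp
      have := h (WithLp.toLp 2 (0, z), hspaceEquiv ha hb hda hdb hd (WithLp.toLp 2 (0, t)))
        ((mem_graph_adjoint_J_directSum ha hb hda hdb hd).2 ⟨Submodule.zero_mem _, hp⟩)
      simpa [LinearIsometryEquiv.inner_map_map] using this

end DirectSum

end KreinVonNeumann

end

theorem lemma1 {𝕜 H : Type*} [RCLike 𝕜] [NormedAddCommGroup H] [InnerProductSpace 𝕜 H]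
    [CompleteSpace H] (a b : H →ₗ.[𝕜] H)
    (ha : KreinVonNeumann.IsPosSymm a) (hb : KreinVonNeumann.IsPosSymm b)
    (hda : Dense (KreinVonNeumann.fdom a)) (hdb : Dense (KreinVonNeumann.fdom b)) :
    ∃ hd : Dense (KreinVonNeumann.fdom (KreinVonNeumann.directSum a b)),
      KreinVonNeumann.directSum (KreinVonNeumann.kreinExt ha hda)
          (KreinVonNeumann.kreinExt hb hdb) =
        KreinVonNeumann.kreinExt (ha.directSum hb) hd := by
  exact ⟨KreinVonNeumann.dense_fdom_directSum ha hb hda hdb,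
    KreinVonNeumann.directSum_kreinExt ha hb hda hdb _⟩
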